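/- **Theorem 1.1.** Suppose that an unknown element of a set is to be determined by adaptive search: queries are asked one after the other, each query is one of a given family of subsets and is answered by YES or NO according to whether the unknown element belongs to it, and each query may depend on the previous answers. The number of queries needed is the minimum, over all adaptive strategies that always determine the unknown element, of the number of queries asked in the worst case. (a) Let $\pi$ be a finite projective plane of order $q$, and let $A(\pi)$ be the number of queries needed to determine an unknown point of $\pi$ when the allowed queries are the single points and the lines of $\pi$. Then $A(\pi)\le 2q-1$. (b) Let $q$ be a prime power and let $V$ be a $3$-dimensional vector space over the field with $q$ elements. Let $\mathrm{PG}(2,q)$ be the projective plane whose points and lines are the $1$- and $2$-dimensional subspaces of $V$, and let $A(3,q)$ be the number of queries needed to determine an unknown $1$-dimensional subspace $\mathbf v$ of $V$ when the allowed queries are all subspaces $U$ of $V$, the answer being YES if and only if $\mathbf v\leqslant U$. Then $A(\mathrm{PG}(2,q))=2q-1$ and $A(3,q)=2q-1$. -/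

import Mathlib

namespace AdaptiveSearch

/-- An adaptive strategy whose queries are indexed by `ι`: either halt, or ask a query and go on
with a strategy that depends on the answer (`yes` or `no`). -/
inductive Strategy (ι : Type*) where
  | halt : Strategy ι
  | ask (i : ι) (yes no : Strategy ι) : Strategy ι

namespace Strategy

variable {ι X : Type*}

/-- The number of queries asked in the worst case. -/
def numQueries : Strategy ι → ℕ
  | halt => 0
  | ask _ yes no => max yes.numQueries no.numQueries + 1

open Classical in
/-- The answers received when the unknown element is `x` and the query `i` asks whether the
unknown element lies in `Q i`. -/
noncomputable def answers (Q : ι → Set X) : Strategy ι → X → List Bool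
  | halt, _ => []
  | ask i yes no, x =>
      if x ∈ Q i then true :: yes.answers Q x else false :: no.answers Q x

/-- The strategy always determines the unknown element: distinct elements never lead to the same
answers. -/
def Determines (Q : ι → Set X) (T : Strategy ι) : Prop :=
  Function.Injective (T.answers Q)

end Strategy

/-- The minimum number of queries (in the worst case) needed in adaptive search to determine an
unknown element of `X` when the available queries are "does the element lie in `Q i`?";
it is `⊤` if no strategy determines the element. -/
noncomputable def adaptiveNumber {ι X : Type*} (Q : ι → Set X) : ℕ∞ :=
  ⨅ (T : Strategy ι) (_ : T.Determines Q), (T.numQueries : ℕ∞)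

/-- The queries in a plane with points `P` and lines `L`: single points and lines. -/
def planeQuery (P L : Type*) [Membership P L] : P ⊕ L → Set P
  | Sum.inl p => {p}
  | Sum.inr l => {x | x ∈ l}

/-- `A(π)`: adaptive search for a point of the plane `π = (P, L)`, with points and lines as
queries. -/
noncomputable def planeNumber (P L : Type*) [Membership P L] : ℕ∞ :=
  adaptiveNumber (planeQuery P L)

section Subspaces

variable (K V : Type*) [Field K] [AddCommGroup V] [Module K V]

/-- The lines of the projective geometry of `V`: the subspaces of `V` of dimension two.
(Its points are the subspaces of dimension one, that is, the elements of `Projectivization K V`.) -/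
def ProjLine : Type _ := {W : Submodule K V // Module.finrank K W = 2}

instance : Membership (Projectivization K V) (ProjLine K V) where
  mem l v := v.submodule ≤ l.1

/-- The query given by a subspace `U`: is the unknown one-dimensional subspace contained in `U`? -/
def subspaceQuery (U : Submodule K V) : Set (Projectivization K V) :=
  {v | v.submodule ≤ U}

/-- `A(n, q)` for an `n`-dimensional vector space `V` over a field `K` with `q` elements: adaptive
search for a one-dimensional subspace of `V`, with all subspaces of `V` as queries. -/
noncomputable def subspaceNumber : ℕ∞ :=
  adaptiveNumber (subspaceQuery K V)

end Subspaces

end AdaptiveSearch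

/-! Upper bound: ask the `q + 1` lines through a point `p`. YES to the first leaves `q + 1` points,
hence at most `1 + q ≤ 2q - 1` queries in all. NO excludes `p`: the other `q` lines now carry at
most `q` candidates each, `q - 1` queries single one out (the last is implied), and `q - 1` point
queries finish.

Lower bound: an adversary who says NO whenever possible makes the strategy produce subspaces that
avoid one point and cover all others (`exists_cover_of_injOn`). Enlarge them to planes of `V` and
send one to infinity. The rest give affine functions on `K ^ 2`, nonzero at the origin, whose
product vanishes elsewhere. The values of the product then have nonzero sum, so by the
Chevalley–Warning argument its degree is at least `2(q - 1)`. With the line at infinity this makes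
`2q - 1`. -/

namespace AdaptiveSearch

/-! ### Strategies on a set of remaining candidates -/

namespace Strategy

variable {ι X : Type*} {Q : ι → Set X}

/-- Injectivity relative to a candidate set `S` lets strategies be assembled recursively, one
subtree per answer. -/
theorem injOn_answers_ask {S : Set X} {i : ι} {Y N : Strategy ι}
    (hY : Set.InjOn (Y.answers Q) (S ∩ Q i)) (hN : Set.InjOn (N.answers Q) (S \ Q i)) :
    Set.InjOn ((ask i Y N).answers Q) S := by
  intro x hx y hy hxy
  by_cases hxi : x ∈ Q i <;> by_cases hyi : y ∈ Q i <;> simp [answers, hxi, hyi] at hxy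
  · exact hY ⟨hx, hxi⟩ ⟨hy, hyi⟩ hxy
  · exact hN ⟨hx, hxi⟩ ⟨hy, hyi⟩ hxy

/-- If single elements are queries, `n` queries suffice for at most `n + 1` candidates. -/
theorem exists_injOn_of_ncard_le (hs : ∀ x, ∃ i, Q i = {x}) [Finite X] :
    ∀ (n : ℕ) (S : Set X), S.ncard ≤ n + 1 →
      ∃ T : Strategy ι, T.numQueries ≤ n ∧ Set.InjOn (T.answers Q) S := by
  intro n
  induction n with
  | zero =>
    intro S hS
    exact ⟨halt, le_rfl, ((Set.ncard_le_one_iff_subsingleton).1 (by simpa using hS)).injOn _⟩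
  | succ n ih =>
    intro S hS
    rcases S.eq_empty_or_nonempty with rfl | ⟨x, hx⟩
    · exact ⟨halt, Nat.zero_le _, Set.injOn_empty _⟩
    obtain ⟨i, hi⟩ := hs x
    obtain ⟨N, hN, hNS⟩ := ih (S \ {x}) (by
      rw [Set.ncard_sdiff_singleton_of_mem hx]; omega)
    refine ⟨ask i halt N, by simp [numQueries, hN], injOn_answers_ask ?_ (hi ▸ hNS)⟩
    rw [hi]
    exact (Set.subsingleton_singleton.anti Set.inter_subset_right).injOn _

/-- If the candidates are covered by `n + 1` queries, each of which contains at most `k + 1`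
candidates, then `n + k` queries suffice. -/
theorem exists_injOn_of_cover (hs : ∀ x, ∃ i, Q i = {x}) [Finite X] (k : ℕ) :
    ∀ (n : ℕ) (t : Finset ι) (S : Set X), t.card ≤ n + 1 → (∀ x ∈ S, ∃ i ∈ t, x ∈ Q i) →
      (∀ i ∈ t, (S ∩ Q i).ncard ≤ k + 1) →
      ∃ T : Strategy ι, T.numQueries ≤ n + k ∧ Set.InjOn (T.answers Q) S := by
  classical
  intro n
  induction n with
  | zero =>
    intro t S ht hc hk
    rcases S.eq_empty_or_nonempty with rfl | ⟨x, hx⟩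
    · exact ⟨halt, Nat.zero_le _, Set.injOn_empty _⟩
    obtain ⟨i, hi, -⟩ := hc x hx
    have hSi : S ∩ Q i = S := by
      refine Set.inter_eq_left.2 fun y hy => ?_
      obtain ⟨j, hj, hyj⟩ := hc y hy
      rwa [Finset.card_le_one.1 (by simpa using ht) i hi j hj]
    rw [zero_add]
    exact exists_injOn_of_ncard_le hs k S (hSi ▸ hk i hi)
  | succ n ih =>
    intro t S ht hc hk
    rcases S.eq_empty_or_nonempty with rfl | ⟨x, hx⟩
    · exact ⟨halt, Nat.zero_le _, Set.injOn_empty _⟩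
    obtain ⟨i, hi, -⟩ := hc x hx
    obtain ⟨Y, hY, hYS⟩ := exists_injOn_of_ncard_le hs k _ (hk i hi)
    obtain ⟨N, hN, hNS⟩ := ih (t.erase i) (S \ Q i)
      (by rw [Finset.card_erase_of_mem hi]; omega)
      (fun y hy => by
        obtain ⟨j, hj, hyj⟩ := hc y hy.1
        exact ⟨j, Finset.mem_erase.2 ⟨fun h => hy.2 (h ▸ hyj), hj⟩, hyj⟩)
      (fun j hj => (Set.ncard_le_ncard (Set.inter_subset_inter_left _ Set.sdiff_subset)).trans
        (hk j (Finset.mem_of_mem_erase hj)))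
    refine ⟨ask i Y N, ?_, injOn_answers_ask hYS hNS⟩
    simp only [numQueries]
    omega

/-- An adversary who answers NO as long as a candidate remains forces the queries answered NO
to cover all candidates but one. -/
theorem exists_cover_of_injOn {T : Strategy ι} :
    ∀ {S : Set X}, S.Nonempty → Set.InjOn (T.answers Q) S →
      ∃ x ∈ S, ∃ t : List ι, t.length ≤ T.numQueries ∧ (∀ i ∈ t, x ∉ Q i) ∧
        ∀ y ∈ S, y ≠ x → ∃ i ∈ t, y ∈ Q i := by
  induction T with
  | halt =>
    rintro S ⟨x, hx⟩ hS
    exact ⟨x, hx, [], le_rfl, by simp, fun y hy hyx => absurd (hS hy hx rfl) hyx⟩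
  | ask i Y N ihY ihN =>
    intro S hS hinj
    by_cases hne : (S \ Q i).Nonempty
    · obtain ⟨x, hx, t, ht, hxt, hcov⟩ := ihN hne (fun a ha b hb hab =>
        hinj ha.1 hb.1 (by simp [answers, ha.2, hb.2, hab]))
      refine ⟨x, hx.1, i :: t, ?_, ?_, fun y hy hyx => ?_⟩
      · simp only [numQueries, List.length_cons]
        omega
      · simpa [hx.2] using hxt
      · by_cases hyi : y ∈ Q i
        · exact ⟨i, by simp, hyi⟩
        · obtain ⟨j, hj, hyj⟩ := hcov y ⟨hy, hyi⟩ hyx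
          exact ⟨j, by simp [hj], hyj⟩
    -- The answer YES is forced and eliminates nobody, so this query is not added to the cover.
    · have hsub : S ⊆ Q i := Set.sdiff_eq_empty.1 (Set.not_nonempty_iff_eq_empty.1 hne)
      obtain ⟨x, hx, t, ht, hcov⟩ := ihY hS (fun a ha b hb hab =>
        hinj ha hb (by simp [answers, hsub ha, hsub hb, hab]))
      refine ⟨x, hx, t, ?_, hcov⟩
      simp only [numQueries]
      omega

end Strategy

/-! ### Upper bound from a pencil of lines -/

open Strategy

/-- If single elements are queries and `q + 1` queries of size at most `q + 1` through a common
element `p` cover everything, then `2 * q - 1` queries suffice. -/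
theorem adaptiveNumber_le_of_pencil {ι X : Type*} {Q : ι → Set X} [Finite X]
    (hs : ∀ x, ∃ i, Q i = {x}) {q : ℕ} (hq : 2 ≤ q) (p : X) (t : Finset ι)
    (ht : t.card ≤ q + 1) (hp : ∀ i ∈ t, p ∈ Q i) (hk : ∀ i ∈ t, (Q i).ncard ≤ q + 1)
    (hc : ∀ x, ∃ i ∈ t, x ∈ Q i) : adaptiveNumber Q ≤ ((2 * q - 1 : ℕ) : ℕ∞) := by
  classical
  obtain ⟨i, hi, -⟩ := hc p
  obtain ⟨Y, hY, hYS⟩ := exists_injOn_of_ncard_le hs q (Set.univ ∩ Q i) (by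
    simpa using hk i hi)
  obtain ⟨N, hN, hNS⟩ := exists_injOn_of_cover hs (q - 1) (q - 1) (t.erase i) (Set.univ \ Q i)
    (by rw [Finset.card_erase_of_mem hi]; omega)
    (fun y hy => by
      obtain ⟨j, hj, hyj⟩ := hc y
      exact ⟨j, Finset.mem_erase.2 ⟨fun h => hy.2 (h ▸ hyj), hj⟩, hyj⟩)
    (fun j hj => by
      have hj' := Finset.mem_of_mem_erase hj
      -- The NO to `Q i` has excluded the common point `p`, which saves one candidate on every other
      -- line.
      have hsub : (Set.univ \ Q i) ∩ Q j ⊆ Q j \ {p} := fun y hy =>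
        ⟨hy.2, fun h => hy.1.2 (h ▸ hp i hi)⟩
      have h1 := Set.ncard_le_ncard hsub
      rw [Set.ncard_sdiff_singleton_of_mem (hp j hj')] at h1
      have h2 := hk j hj'
      omega)
  refine iInf₂_le_of_le (ask i Y N) (Set.injOn_univ.1 (injOn_answers_ask hYS hNS)) ?_
  simp only [numQueries]
  -- The YES branch costs `q + 1`, which is at most `2 * q - 1` because `2 ≤ q`.
  exact_mod_cast (by omega)

theorem planeNumber_le (P L : Type*) [Membership P L] [Finite P] [Finite L]
    [Configuration.ProjectivePlane P L] :
    planeNumber P L ≤ ((2 * Configuration.ProjectivePlane.order P L - 1 : ℕ) : ℕ∞) := by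
  classical
  obtain ⟨p, -⟩ := Configuration.ProjectivePlane.exists_config (P := P) (L := L)
  have hcard := Configuration.ProjectivePlane.lineCount_eq L p
  have hline : ∃ l : L, p ∈ l := by
    by_contra! h
    have : IsEmpty {l : L // p ∈ l} := ⟨fun l => h l.1 l.2⟩
    simp [Configuration.lineCount] at hcard
  refine adaptiveNumber_le_of_pencil (fun x => ⟨Sum.inl x, rfl⟩)
    (Configuration.ProjectivePlane.one_lt_order P L) p
    ((Set.toFinite {l : L | p ∈ l}).toFinset.map Function.Embedding.inr) ?_ ?_ ?_ ?_
  · rw [Finset.card_map, ← Set.ncard_eq_toFinset_card]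
    exact hcard.le
  · simp [planeQuery]
  · simp only [Finset.mem_map, Set.Finite.mem_toFinset]
    rintro _ ⟨l, -, rfl⟩
    exact (Configuration.ProjectivePlane.pointCount_eq P l).le
  · intro x
    by_cases hx : x = p
    · obtain ⟨l, hl⟩ := hline
      exact ⟨Sum.inr l, by simpa using hl, by simpa [planeQuery, hx] using hl⟩
    · obtain ⟨hxl, hpl⟩ := Configuration.HasLines.mkLine_ax (L := L) hx
      exact ⟨Sum.inr (Configuration.HasLines.mkLine hx), by simpa using hpl, hxl⟩

/-! ### Points and lines as subspaces -/

section Subspaces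

variable {K V : Type*} [Field K] [AddCommGroup V] [Module K V]

open Module

theorem mk_mem_subspaceQuery {U : Submodule K V} {v : V} (hv : v ≠ 0) :
    Projectivization.mk K v hv ∈ subspaceQuery K V U ↔ v ∈ U := by
  simp [subspaceQuery]

theorem mem_subspaceQuery {U : Submodule K V} {v : Projectivization K V} :
    v ∈ subspaceQuery K V U ↔ v.rep ∈ U := by
  rw [← mk_mem_subspaceQuery v.rep_nonzero, v.mk_rep]

theorem subspaceQuery_submodule (v : Projectivization K V) :
    subspaceQuery K V v.submodule = {v} := by
  ext w
  refine ⟨fun h => Projectivization.submodule_injective ?_, fun h => h ▸ le_refl w.submodule⟩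
  have : FiniteDimensional K v.submodule := by
    rw [v.submodule_eq]; infer_instance
  exact Submodule.eq_of_le_of_finrank_eq h (by simp [Projectivization.finrank_submodule])

/-- These points are images of the points of the projective line over `U`. -/
theorem ncard_subspaceQuery_le [Finite K] {U : Submodule K V} (hU : finrank K U = 2) :
    (subspaceQuery K V U).ncard ≤ Nat.card K + 1 := by
  have : FiniteDimensional K U := .of_finrank_pos (by omega)
  have : Finite U := Module.finite_of_finite K
  rw [← Projectivization.card_of_finrank_two K U hU, ← Set.ncard_univ]
  refine (Set.ncard_le_ncard ?_ (Set.toFinite _)).trans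
    (Set.ncard_image_le (f := Projectivization.map U.subtype U.injective_subtype))
  intro w hw
  have hr := mem_subspaceQuery.1 hw
  refine ⟨Projectivization.mk K ⟨w.rep, hr⟩ (fun h => w.rep_nonzero (congrArg Subtype.val h)),
    trivial, ?_⟩
  simp [Projectivization.map_mk, Projectivization.mk_rep]

/-- The pencil of lines through a point of a projective plane over a finite field. -/
theorem exists_pencil [Finite K] (hV : finrank K V = 3) (p : Projectivization K V) :
    ∃ t : Finset (Submodule K V), t.card ≤ Nat.card K + 1 ∧
      (∀ U ∈ t, p ∈ subspaceQuery K V U ∧ finrank K U = 2) ∧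
      ∀ x, ∃ U ∈ t, x ∈ subspaceQuery K V U := by
  classical
  have : FiniteDimensional K V := .of_finrank_pos (by omega)
  have : Finite V := Module.finite_of_finite K
  have hquot : finrank K (V ⧸ p.submodule) = 2 := by
    have := p.submodule.finrank_quotient_add_finrank
    rw [p.finrank_submodule] at this
    omega
  have : Finite (V ⧸ p.submodule) := Module.finite_of_finite K
  have : Fintype (Projectivization K (V ⧸ p.submodule)) := Fintype.ofFinite _
  -- Lines through `p` are the preimages of the points of the quotient by `p`.
  let W : Projectivization K (V ⧸ p.submodule) → Submodule K V := fun d =>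
    LinearMap.ker (d.submodule.mkQ.comp p.submodule.mkQ)
  have hW : ∀ d x, x ∈ W d ↔ p.submodule.mkQ x ∈ d.submodule := fun d x => by
    simp [W]
  have hcard := Projectivization.card_of_finrank_two K (V ⧸ p.submodule) hquot
  refine ⟨Finset.univ.image W, ?_, ?_, ?_⟩
  · exact Finset.card_image_le.trans (by rw [Finset.card_univ, ← Nat.card_eq_fintype_card, hcard])
  · simp only [Finset.mem_image, Finset.mem_univ, true_and]
    rintro _ ⟨d, rfl⟩
    constructor
    · have : p.submodule.mkQ p.rep = 0 := by
        rw [Submodule.mkQ_apply, Submodule.Quotient.mk_eq_zero, p.submodule_eq]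
        exact Submodule.mem_span_singleton_self _
      rw [mem_subspaceQuery, hW, this]
      exact zero_mem _
    · have h1 := LinearMap.finrank_range_add_finrank_ker
        (d.submodule.mkQ.comp p.submodule.mkQ)
      rw [LinearMap.range_eq_top.2
        (by
          rw [LinearMap.coe_comp]
          exact d.submodule.mkQ_surjective.comp p.submodule.mkQ_surjective), finrank_top] at h1
      have h2 := d.submodule.finrank_quotient_add_finrank
      rw [d.finrank_submodule] at h2
      change finrank K (LinearMap.ker (d.submodule.mkQ.comp p.submodule.mkQ)) = 2
      omega
  · intro x
    have : Nontrivial (V ⧸ p.submodule) := nontrivial_of_finrank_pos (R := K) (by omega)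
    by_cases hx : p.submodule.mkQ x.rep = 0
    · obtain ⟨d⟩ : Nonempty (Projectivization K (V ⧸ p.submodule)) := inferInstance
      refine ⟨W d, Finset.mem_image_of_mem _ (Finset.mem_univ _), ?_⟩
      rw [mem_subspaceQuery, hW, hx]
      exact zero_mem _
    · refine ⟨W (.mk K _ hx), Finset.mem_image_of_mem _ (Finset.mem_univ _), ?_⟩
      rw [mem_subspaceQuery, hW, Projectivization.submodule_mk]
      exact Submodule.mem_span_singleton_self _

theorem subspaceNumber_le [Finite K] (hV : finrank K V = 3) :
    subspaceNumber K V ≤ ((2 * Nat.card K - 1 : ℕ) : ℕ∞) := by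
  have : FiniteDimensional K V := .of_finrank_pos (by omega)
  have : Finite V := Module.finite_of_finite K
  have : Nontrivial V := nontrivial_of_finrank_pos (R := K) (by omega)
  obtain ⟨p⟩ : Nonempty (Projectivization K V) := inferInstance
  obtain ⟨t, ht, hU, hc⟩ := exists_pencil hV p
  exact adaptiveNumber_le_of_pencil (fun x => ⟨x.submodule, subspaceQuery_submodule x⟩)
    Finite.one_lt_card p t ht (fun U h => (hU U h).1)
    (fun U h => ncard_subspaceQuery_le (hU U h).2) hc

theorem planeNumber_projectivization_le [Finite K] (hV : finrank K V = 3) :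
    planeNumber (Projectivization K V) (ProjLine K V) ≤ ((2 * Nat.card K - 1 : ℕ) : ℕ∞) := by
  classical
  have : FiniteDimensional K V := .of_finrank_pos (by omega)
  have : Finite V := Module.finite_of_finite K
  have : Nontrivial V := nontrivial_of_finrank_pos (R := K) (by omega)
  obtain ⟨p⟩ : Nonempty (Projectivization K V) := inferInstance
  obtain ⟨t, ht, hU, hc⟩ := exists_pencil hV p
  let f : {U // U ∈ t} → Projectivization K V ⊕ ProjLine K V := fun U =>
    Sum.inr ⟨U.1, (hU U.1 U.2).2⟩
  have hf : ∀ U, planeQuery _ _ (f U) = subspaceQuery K V U.1 := fun U => rfl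
  refine adaptiveNumber_le_of_pencil (fun x => ⟨Sum.inl x, rfl⟩)
    Finite.one_lt_card p (t.attach.image f) (Finset.card_image_le.trans (by simpa using ht))
    ?_ ?_ ?_
  · simp only [Finset.mem_image]
    rintro _ ⟨U, -, rfl⟩
    exact (hf U).symm ▸ (hU U.1 U.2).1
  · simp only [Finset.mem_image]
    rintro _ ⟨U, -, rfl⟩
    exact (hf U).symm ▸ ncard_subspaceQuery_le (hU U.1 U.2).2
  · intro x
    obtain ⟨U, h, hx⟩ := hc x
    exact ⟨f ⟨U, h⟩, Finset.mem_image_of_mem _ (Finset.mem_attach _ _), hx⟩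

/-! ### Lower bound by the polynomial method -/

/-- Affine functions on `K ^ σ` whose product vanishes everywhere except at the origin number at
least `(|K| - 1) * |σ|`. -/
theorem le_length_of_prod_affine_eq_zero [Finite K] {σ : Type*} [Fintype σ]
    (fs : List (K × (σ → K))) (h0 : ∀ f ∈ fs, f.1 ≠ 0)
    (h : ∀ c : σ → K, c ≠ 0 → ∃ f ∈ fs, f.1 + ∑ i, c i * f.2 i = 0) :
    (Nat.card K - 1) * Fintype.card σ ≤ fs.length := by
  classical
  have : Fintype K := Fintype.ofFinite K
  let g : K × (σ → K) → MvPolynomial σ K := fun f =>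
    MvPolynomial.C f.1 + ∑ i, MvPolynomial.X i * MvPolynomial.C (f.2 i)
  have hg : ∀ c f, MvPolynomial.eval c (g f) = f.1 + ∑ i, c i * f.2 i := fun c f => by
    simp [g]
  have hdeg : ∀ f, (g f).totalDegree ≤ 1 := fun f => by
    refine (MvPolynomial.totalDegree_add _ _).trans (max_le (by simp) ?_)
    refine MvPolynomial.totalDegree_finsetSum_le fun i _ => ?_
    exact (MvPolynomial.totalDegree_mul _ _).trans (by simp)
  have heval : ∀ c, MvPolynomial.eval c (fs.map g).prod
      = (fs.map fun f => f.1 + ∑ i, c i * f.2 i).prod := fun c => by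
    rw [map_list_prod, List.map_map]
    congr 1
    exact List.map_congr_left fun f _ => hg c f
  by_contra! hlt
  -- A polynomial of degree below `(|K| - 1) * |σ|` has values summing to zero, but here only the
  -- origin contributes.
  have hsum := MvPolynomial.sum_eval_eq_zero (fs.map g).prod (by
    refine lt_of_le_of_lt ((MvPolynomial.totalDegree_list_prod _).trans ?_)
      (Nat.card_eq_fintype_card (α := K) ▸ hlt)
    rw [List.map_map]
    refine (List.sum_le_card_nsmul _ 1 ?_).trans (by simp)
    simp only [List.mem_map]
    rintro _ ⟨f, -, rfl⟩
    exact hdeg f)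
  rw [Finset.sum_eq_single (0 : σ → K), heval] at hsum
  · obtain ⟨f, hf, hf0⟩ := List.mem_map.1 (List.prod_eq_zero_iff.1 hsum)
    exact h0 f hf (by simpa using hf0)
  · intro c _ hc
    obtain ⟨f, hf, hf0⟩ := h c hc
    rw [heval]
    exact List.prod_eq_zero (List.mem_map.2 ⟨f, hf, hf0⟩)
  · simp

/-- Subspaces that cover all points of a projective plane but one, and do not contain that one,
number at least `2 * q - 1`. -/
theorem two_mul_card_sub_one_le_length [Finite K] (hV : finrank K V = 3)
    (v : Projectivization K V) (t : List (Submodule K V))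
    (hv : ∀ U ∈ t, v ∉ subspaceQuery K V U)
    (hc : ∀ w, w ≠ v → ∃ U ∈ t, w ∈ subspaceQuery K V U) :
    2 * Nat.card K - 1 ≤ t.length := by
  have : FiniteDimensional K V := .of_finrank_pos (by omega)
  -- Each subspace is enlarged to the kernel of a functional not vanishing at `v`; outside `t` the
  -- value is a dummy.
  have hfun : ∀ U : Submodule K V, ∃ f : V →ₗ[K] K, U ∈ t → f v.rep ≠ 0 ∧ U ≤ LinearMap.ker f := by
    intro U
    by_cases hU : U ∈ t
    · obtain ⟨f, hf⟩ := Submodule.exists_le_ker_of_notMem (fun h => hv U hU (mem_subspaceQuery.2 h))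
      exact ⟨f, fun _ => hf⟩
    · exact ⟨0, fun h => absurd h hU⟩
  choose f hf using hfun
  cases t with
  | nil =>
    have hall : ∀ w : V, w ∈ v.submodule := by
      intro w
      by_cases hw : w = 0
      · simp [hw]
      · by_contra hwv
        obtain ⟨U, hU, -⟩ := hc (.mk K w hw) (fun h => hwv (by
          rw [← h, Projectivization.submodule_mk]
          exact Submodule.mem_span_singleton_self _))
        simp at hU
    have h1 := v.finrank_submodule
    rw [Submodule.eq_top_iff'.2 hall, finrank_top] at h1
    omega
  | cons U t =>
    obtain ⟨hU, -⟩ := hf U (by simp)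
    have hker : finrank K (LinearMap.ker (f U)) = 2 := by
      have h1 := LinearMap.finrank_range_add_finrank_ker (f U)
      rw [LinearMap.range_eq_top.2 (LinearMap.surjective (fun h => hU (by simp [h]))),
        finrank_top, finrank_self] at h1
      omega
    -- With `ker (f U)` as line at infinity, `c ↦ v.rep + ∑ i, c i • b i` is an affine chart with
    -- `v` as origin.
    let b := finBasisOfFinrankEq K (LinearMap.ker (f U)) hker
    have hle := le_length_of_prod_affine_eq_zero (σ := Fin 2)
      (t.map fun U' => (f U' v.rep, fun i => f U' (b i))) (by
        simp only [List.mem_map]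
        rintro _ ⟨U', hU', rfl⟩
        exact (hf U' (by simp [hU'])).1) (by
        intro c hc0
        have hs : f U (v.rep + ∑ i, c i • (b i : V)) = f U v.rep := by
          simp
        have hw : v.rep + ∑ i, c i • (b i : V) ≠ 0 := fun h => hU (by
          rw [← hs, h, map_zero])
        obtain ⟨U', hU', hwU⟩ := hc (.mk K _ hw) (by
          intro h
          obtain ⟨a, ha⟩ := (Projectivization.mk_eq_mk_iff' K _ _ hw v.rep_nonzero).1
            (h.trans v.mk_rep.symm)
          have ha1 : a = 1 := by
            have := congrArg (f U) ha
            rw [hs, map_smul, smul_eq_mul] at this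
            exact mul_right_cancel₀ hU (by rw [this, one_mul])
          rw [ha1, one_smul, left_eq_add] at ha
          have hz : ∑ i, c i • b i = 0 := Subtype.ext (by simpa using ha)
          exact hc0 (funext (Fintype.linearIndependent_iff.1 b.linearIndependent c hz)))
        have hwker := (hf U' hU').2 ((mk_mem_subspaceQuery hw).1 hwU)
        -- On the chart `f U` is constant and nonzero, so the covering subspace is among the others.
        have hne : U' ≠ U := by
          rintro rfl
          exact hU (by rw [← hs]; exact hwker)
        refine ⟨_, List.mem_map.2 ⟨U', (List.mem_cons.1 hU').resolve_left hne, rfl⟩, ?_⟩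
        simpa using hwker)
    simp only [Fintype.card_fin, List.length_map] at hle
    simp only [List.length_cons]
    omega

/-- An arbitrary family of subspace queries is allowed so that both numbers are covered: points and
lines are subspaces too. -/
theorem le_adaptiveNumber_of_subspaceQuery [Finite K] (hV : finrank K V = 3) {ι : Type*}
    {Q : ι → Set (Projectivization K V)} (hQ : ∀ i, ∃ U, Q i = subspaceQuery K V U) :
    ((2 * Nat.card K - 1 : ℕ) : ℕ∞) ≤ adaptiveNumber Q := by
  refine le_iInf₂ fun T hT => ?_
  have : Nontrivial V := nontrivial_of_finrank_pos (R := K) (by omega)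
  choose U hU using hQ
  obtain ⟨x, -, t, ht, hx, hc⟩ := exists_cover_of_injOn (S := Set.univ) Set.univ_nonempty
    (Set.injOn_univ.2 hT)
  refine Nat.cast_le.2 (le_trans ?_ ht)
  rw [← List.length_map (as := t) U]
  refine two_mul_card_sub_one_le_length hV x _ ?_ fun w hw => ?_
  · simp only [List.mem_map]
    rintro _ ⟨i, hi, rfl⟩
    exact hU i ▸ hx i hi
  · obtain ⟨i, hi, hwi⟩ := hc w trivial hw
    exact ⟨U i, List.mem_map_of_mem hi, hU i ▸ hwi⟩

end Subspaces

end AdaptiveSearch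

theorem theorem1p1 :
    (∀ (q : ℕ) (P L : Type*) [Membership P L] [Finite P] [Finite L]
      [Configuration.ProjectivePlane P L],
      Configuration.ProjectivePlane.order P L = q →
        AdaptiveSearch.planeNumber P L ≤ ((2 * q - 1 : ℕ) : ℕ∞)) ∧
    (∀ q : ℕ, IsPrimePow q →
      ∀ (K V : Type*) [Field K] [AddCommGroup V] [Module K V],
        Nat.card K = q → Module.finrank K V = 3 →
          AdaptiveSearch.planeNumber (Projectivization K V) (AdaptiveSearch.ProjLine K V)
            = ((2 * q - 1 : ℕ) : ℕ∞) ∧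
          AdaptiveSearch.subspaceNumber K V = ((2 * q - 1 : ℕ) : ℕ∞)) := by
  refine ⟨?_, ?_⟩
  · rintro q P L _ _ _ _ rfl
    exact AdaptiveSearch.planeNumber_le P L
  · rintro q hq K V _ _ _ rfl hV
    have : Finite K := Nat.finite_of_card_ne_zero hq.ne_zero
    refine ⟨le_antisymm (AdaptiveSearch.planeNumber_projectivization_le hV)
        (AdaptiveSearch.le_adaptiveNumber_of_subspaceQuery hV ?_),
      le_antisymm (AdaptiveSearch.subspaceNumber_le hV)
        (AdaptiveSearch.le_adaptiveNumber_of_subspaceQuery hV fun U => ⟨U, rfl⟩)⟩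
    rintro (p | l)
    · exact ⟨p.submodule, (AdaptiveSearch.subspaceQuery_submodule p).symm⟩
    · exact ⟨l.1, rfl⟩
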